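/- For $n\ge 0$, let $A_n$ be the Laver table: the unique operation $\rhd$ on $\{1,2,\dots,2^n\}$ with $a\rhd(b\rhd c)=(a\rhd b)\rhd(a\rhd c)$ and $a\rhd 1\equiv a+1 \pmod{2^n}$. For $k\ge 0$, let $C^k(A_n)$ be the abelian group of maps $A_n^{\times k}\to\mathbb{Z}$ (so $C^0(A_n)=\mathbb{Z}$), with the rack cohomology differential $d^k\colon C^k(A_n)\to C^{k+1}(A_n)$, $$(d^k\phi)(a_1,\dots,a_{k+1})=\sum_{i=1}^{k}(-1)^{i-1}\bigl(\phi(a_1,\dots,a_{i-1},a_i\rhd a_{i+1},\dots,a_i\rhd a_{k+1})-\phi(a_1,\dots,a_{i-1},a_{i+1},\dots,a_{k+1})\bigr),$$ so that $d^0=0$. Let $Z^k(A_n)=\ker d^k$, $B^k(A_n)=\operatorname{im} d^{k-1}$ (with $B^0(A_n)=0$) and $H^k(A_n)=Z^k(A_n)/B^k(A_n)$. For a tuple $\mathbf a$, let $\delta_{\mathbf a}$ be the map with value $1$ at $\mathbf a$ and $0$ elsewhere. Let $N\in A_n$ be the element $2^n-1$, read modulo $2^n$ if $n=0$ (so $N=1$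 in $A_0=\{1\}$). Put $P_k(x)=\dfrac{x^k-x^{k \bmod 2}}{x+1}$, where $k\bmod 2\in\{0,1\}$. Then for all $n,k\ge 0$: 1. $B^k(A_n)$ is a free $\mathbb{Z}$-module of rank $P_k(2^n)$, with a basis given by the maps $d^{k-1}\delta_{\mathbf a}$ for all $\mathbf a\in A_n^{\times(k-1)}$ satisfying $a_1=\dots=a_{2t}=N$ and $a_{2t+1}\ne N$ for some integer $t$ with $0\le t\le \tfrac{k}{2}-1$ (there are no such tuples, and the basis is empty, for $k\le 1$). 2. $H^k(A_n)$ is freely generated, as a $\mathbb{Z}$-module, by the class of the constant map $\phi^0\colon\mathbf b\mapsto 1$ (which is a cocycle). 3. $Z^k(A_n)$ is a free $\mathbb{Z}$-module of rank $P_k(2^n)+1$, with a basis obtained by adding $\phi^0$ to the above basis of $B^k(A_n)$. -/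

import Mathlib

/-! ### Laver tables -/

/-- The operation of the table of size `N`, on natural numbers `1, …, N`. It is given by
`N ▹ b = b`, `a ▹ 1 = a + 1` and `a ▹ (b + 1) = (a ▹ b) ▹ (a + 1)` for `a < N`.
The last branch is never reached, as `a < a ▹ b` for `a < N` (see `laverOp_gt_le`); it only
makes the recursion visibly well-founded. -/
def laverOp (N a b : ℕ) : ℕ :=
  if _h : N ≤ a then b
  else if _hb : b ≤ 1 then a + 1
  else if _hc : a < laverOp N a (b - 1) then laverOp N (laverOp N a (b - 1)) (a + 1)
  else a + 1
termination_by (N - a, b)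
decreasing_by
  · exact Prod.Lex.right _ (by omega)
  · exact Prod.Lex.left _ _ (by omega)

theorem laverOp_of_le {N a : ℕ} (h : N ≤ a) (b : ℕ) : laverOp N a b = b := by
  rw [laverOp, dif_pos h]

theorem laverOp_one {N a : ℕ} (h : a < N) : laverOp N a 1 = a + 1 := by
  rw [laverOp, dif_neg (by omega), dif_pos le_rfl]

theorem laverOp_gt_le {N : ℕ} : ∀ (i a : ℕ), N - a ≤ i → a < N → ∀ b,
    a < laverOp N a b ∧ laverOp N a b ≤ N := by
  intro i
  induction i with
  | zero => intro a h1 h2; omega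
  | succ i ih =>
    intro a h1 h2 b
    rw [laverOp, dif_neg (by omega)]
    split_ifs with hb hc
    · omega
    · rcases lt_or_ge (laverOp N a (b - 1)) N with h | h
      · have := ih (laverOp N a (b - 1)) (by omega) h (a + 1)
        omega
      · rw [laverOp_of_le h]; omega
    · omega

theorem laverOp_gt {N a : ℕ} (h : a < N) (b : ℕ) : a < laverOp N a b :=
  (laverOp_gt_le _ a le_rfl h b).1

theorem laverOp_le {N a : ℕ} (h : a < N) (b : ℕ) : laverOp N a b ≤ N :=
  (laverOp_gt_le _ a le_rfl h b).2

theorem laverOp_succ {N a : ℕ} (h : a < N) {b : ℕ} (hb : 1 ≤ b) :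
    laverOp N a (b + 1) = laverOp N (laverOp N a b) (a + 1) := by
  conv_lhs => rw [laverOp]
  rw [dif_neg (by omega), dif_neg (by omega)]
  simp only [Nat.add_sub_cancel]
  rw [dif_pos (laverOp_gt h b)]

theorem laverOp_period {N a p : ℕ} (h : a < N) (hp : 1 ≤ p) (hN : laverOp N a p = N) :
    ∀ b, 1 ≤ b → laverOp N a (p + b) = laverOp N a b := by
  intro b hb
  induction b, hb using Nat.le_induction with
  | base => rw [laverOp_succ h hp, hN, laverOp_of_le le_rfl, laverOp_one h]
  | succ b hb ih => rw [← add_assoc, laverOp_succ h (by omega), ih, laverOp_succ h hb]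

theorem laverOp_period_mul {N a p : ℕ} (h : a < N) (hp : 1 ≤ p) (hN : laverOp N a p = N) :
    ∀ j b, 1 ≤ b → laverOp N a (p * j + b) = laverOp N a b := by
  intro j
  induction j with
  | zero => intro b _; simp
  | succ j ih =>
    intro b hb
    rw [show p * (j + 1) + b = p + (p * j + b) by ring,
      laverOp_period h hp hN _ (by omega), ih b hb]

theorem laverOp_mul {N a p : ℕ} (h : a < N) (hp : 1 ≤ p) (hN : laverOp N a p = N)
    {b : ℕ} (hb : 1 ≤ b) (hd : p ∣ b) : laverOp N a b = N := by
  obtain ⟨j, rfl⟩ := hd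
  obtain ⟨j, rfl⟩ : ∃ i, j = i + 1 := ⟨j - 1, by
    rcases j with _ | j
    · simp at hb
    · simp⟩
  rw [mul_add, mul_one, laverOp_period_mul h hp hN _ _ hp, hN]

theorem laverOp_congr {N a : ℕ} (h : a < N) (hN : laverOp N a N = N)
    {b c : ℕ} (hb : 1 ≤ b) (hc : 1 ≤ c) (hbc : b ≡ c [MOD N]) :
    laverOp N a b = laverOp N a c := by
  wlog hle : b ≤ c generalizing b c
  · exact (this hc hb hbc.symm (by omega)).symm
  obtain ⟨j, hj⟩ := (Nat.modEq_iff_dvd' hle).1 hbc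
  rw [show c = N * j + b by omega, laverOp_period_mul h (by omega) hN _ _ hb]

theorem laverOp_zero {N : ℕ} (hN : 1 ≤ N) : ∀ b, 1 ≤ b → laverOp N 0 b ≡ b [MOD N] := by
  intro b hb
  induction b, hb using Nat.le_induction with
  | base => rw [laverOp_one (by omega)]
  | succ b hb ih =>
    rw [laverOp_succ (by omega) hb]
    rcases lt_or_ge (laverOp N 0 b) N with h | h
    · rw [laverOp_one h]; exact ih.add_right 1
    · have he : laverOp N 0 b = N := le_antisymm (laverOp_le (by omega) b) h
      rw [he] at ih ⊢
      rw [laverOp_of_le le_rfl]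
      have h0 : 0 ≡ b [MOD N] := by
        have : N ≡ 0 [MOD N] := by simp [Nat.ModEq]
        exact this.symm.trans ih
      exact h0.add_right 1

/-- Reduction of the table of size `2 M` modulo `M`. -/
theorem laverOp_reduce {M : ℕ} (hM : 1 ≤ M) (hK : ∀ a < M, laverOp M a M = M) :
    ∀ i a, 2 * M - a ≤ i → a ≤ 2 * M → ∀ b, 1 ≤ b →
      laverOp (2 * M) a b ≡ laverOp M (a % M) b [MOD M] := by
  intro i
  induction i with
  | zero =>
    intro a h1 h2 b hb
    obtain rfl : a = 2 * M := by omega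
    rw [laverOp_of_le le_rfl, Nat.mul_mod_left]
    exact (laverOp_zero hM b hb).symm
  | succ i ih =>
    intro a h1 h2 b hb
    rcases h2.eq_or_lt with rfl | h2
    · rw [laverOp_of_le le_rfl, Nat.mul_mod_left]
      exact (laverOp_zero hM b hb).symm
    have ham : a % M < M := Nat.mod_lt _ (by omega)
    induction b, hb using Nat.le_induction with
    | base =>
      rw [laverOp_one h2, laverOp_one ham]
      exact (Nat.mod_modEq a M).symm.add_right 1
    | succ b hb ihb =>
      rw [laverOp_succ h2 hb, laverOp_succ ham hb]
      have hgt := laverOp_gt h2 b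
      have hle := laverOp_le h2 b
      have hle' := laverOp_le ham b
      refine (ih (laverOp (2 * M) a b) (by omega) hle (a + 1) (by omega)).trans ?_
      rw [ihb]
      rw [laverOp_congr (Nat.mod_lt _ (by omega)) (hK _ (Nat.mod_lt _ (by omega)))
        (by omega : 1 ≤ a + 1) (by omega : 1 ≤ a % M + 1) ((Nat.mod_modEq a M).symm.add_right 1)]
      rcases hle'.eq_or_lt with h | h
      · rw [h, Nat.mod_self, laverOp_of_le le_rfl]
        exact laverOp_zero hM _ (by omega)
      · rw [Nat.mod_eq_of_lt h]

theorem laverOp_top_double {M : ℕ} (hM : 1 ≤ M) (hK : ∀ a < M, laverOp M a M = M) :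
    ∀ a < 2 * M, laverOp (2 * M) a (2 * M) = 2 * M := by
  intro a ha
  have hred : ∀ b, 1 ≤ b → laverOp (2 * M) a b ≡ laverOp M (a % M) b [MOD M] :=
    laverOp_reduce hM hK _ a le_rfl ha.le
  have ham : a % M < M := Nat.mod_lt _ (by omega)
  have hgt := laverOp_gt ha
  have hle := laverOp_le ha
  -- values divisible by `M`
  have hmult : ∀ x, 0 < x → x ≤ 2 * M → M ∣ x → x = M ∨ x = 2 * M := by
    rintro x h1 h2 ⟨j, rfl⟩
    have : j ≤ 2 := by
      by_contra hj
      have : M * 3 ≤ M * j := Nat.mul_le_mul_left _ (by omega)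
      omega
    interval_cases j
    · simp at h1
    · left; ring
    · right; ring
  have hgM : ∀ b, laverOp M (a % M) b = M ↔ M ∣ laverOp M (a % M) b := fun b =>
    ⟨fun h => by rw [h], fun h => le_antisymm (laverOp_le ham b)
      (Nat.le_of_dvd (by have := laverOp_gt ham b; omega) h)⟩
  have hdvd : ∀ b, 1 ≤ b → (M ∣ laverOp (2 * M) a b ↔ laverOp M (a % M) b = M) := by
    intro b hb
    rw [hgM]
    exact (hred b hb).dvd_iff dvd_rfl
  rcases le_or_gt M a with haM | haM
  · have h1 := (hdvd (2 * M) (by omega)).2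
      (laverOp_mul ham hM (hK _ ham) (by omega) (Dvd.intro_left 2 rfl))
    rcases hmult _ (by have := hgt (2 * M); omega) (hle _) h1 with h | h
    · have := hgt (2 * M); omega
    · exact h
  -- the period of `a` modulo `M`
  classical
  have hex : ∃ p, 1 ≤ p ∧ laverOp M (a % M) p = M := ⟨M, hM, hK _ ham⟩
  obtain ⟨hp1, hpM⟩ := Nat.find_spec hex
  have hmin : ∀ q, 1 ≤ q → q < Nat.find hex → laverOp M (a % M) q ≠ M :=
    fun q h1 h2 h3 => Nat.find_min hex h2 ⟨h1, h3⟩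
  generalize Nat.find hex = p at hp1 hpM hmin
  have hpd : p ∣ M := by
    by_contra hnd
    have hr : 1 ≤ M % p := Nat.one_le_iff_ne_zero.2 fun h => hnd (Nat.dvd_of_mod_eq_zero h)
    have h := laverOp_period_mul ham hp1 hpM (M / p) (M % p) hr
    rw [Nat.div_add_mod, hK _ ham] at h
    exact hmin _ hr (Nat.mod_lt _ (by omega)) h.symm
  rcases hmult _ (by have := hgt p; omega) (hle p) ((hdvd p hp1).2 hpM) with h | h
  · have key : ∀ b, 1 ≤ b → b ≤ p → M < laverOp (2 * M) a (p + b) := by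
      intro b hb
      induction b, hb using Nat.le_induction with
      | base =>
        intro _
        rw [laverOp_succ ha hp1, h]
        exact laverOp_gt (by omega) _
      | succ b hb ih =>
        intro hbp
        have h1 := ih (by omega)
        have h2 : laverOp (2 * M) a (p + b) < 2 * M := by
          refine lt_of_le_of_ne (hle _) fun h3 => hmin b hb (by omega) ?_
          rw [← laverOp_period ham hp1 hpM b hb, ← hdvd _ (by omega), h3]
          exact Dvd.intro_left 2 rfl
        rw [← add_assoc, laverOp_succ ha (by omega)]
        exact h1.trans (laverOp_gt h2 _)
    have h2 : laverOp (2 * M) a (p + p) = 2 * M := by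
      have h3 := key p hp1 le_rfl
      have h4 : M ∣ laverOp (2 * M) a (p + p) := by
        rw [hdvd _ (by omega), laverOp_period ham hp1 hpM p hp1, hpM]
      rcases hmult _ (by omega) (hle _) h4 with h5 | h5 <;> omega
    refine laverOp_mul ha (by omega) h2 (by omega) ?_
    rw [← two_mul]
    exact Nat.mul_dvd_mul_left 2 hpd
  · exact laverOp_mul ha hp1 h (by omega) (hpd.mul_left 2)

theorem laverOp_top (n : ℕ) : ∀ a < 2 ^ n, laverOp (2 ^ n) a (2 ^ n) = 2 ^ n := by
  induction n with
  | zero =>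
    intro a ha
    obtain rfl : a = 0 := by simpa using ha
    exact laverOp_one ha
  | succ n ih =>
    have := laverOp_top_double (Nat.one_le_two_pow (n := n)) ih
    rwa [← pow_succ'] at this

theorem laverOp_distrib {N : ℕ} (hK : ∀ a < N, laverOp N a N = N) :
    ∀ i a, N - a ≤ i → a ≤ N → ∀ j b, N - b ≤ j → b ≤ N → ∀ c, 1 ≤ b → 1 ≤ c →
      laverOp N a (laverOp N b c) = laverOp N (laverOp N a b) (laverOp N a c) := by
  intro i
  induction i with
  | zero =>
    intro a h1 h2 j b _ _ c _ _
    rw [laverOp_of_le (by omega), laverOp_of_le (by omega : N ≤ a),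
      laverOp_of_le (by omega : N ≤ a)]
  | succ i ihi =>
    intro a h1 h2
    rcases h2.eq_or_lt with h2 | h2
    · intro j b _ _ c _ _
      rw [laverOp_of_le (by omega), laverOp_of_le (by omega : N ≤ a),
        laverOp_of_le (by omega : N ≤ a)]
    intro j
    have htop : ∀ c, laverOp N a (laverOp N N c)
        = laverOp N (laverOp N a N) (laverOp N a c) := by
      intro c
      rw [hK a h2, laverOp_of_le le_rfl, laverOp_of_le le_rfl]
    induction j with
    | zero =>
      intro b h3 h4 c _ _
      obtain rfl : b = N := by omega
      exact htop c
    | succ j ihj =>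
      intro b h3 h4 c hb hc
      rcases h4.eq_or_lt with rfl | h4
      · exact htop c
      induction c, hc using Nat.le_induction with
      | base => rw [laverOp_one h4, laverOp_one h2, laverOp_succ h2 hb]
      | succ c hc ihc =>
        have g1 := laverOp_gt h4 c
        have g2 := laverOp_le h4 c
        have g3 := laverOp_gt h2 b
        have g4 := laverOp_le h2 b
        have g5 := laverOp_gt h2 c
        have g6 := laverOp_le h2 c
        rw [laverOp_succ h4 hc, ihj (laverOp N b c) (by omega) g2 (b + 1) (by omega) (by omega),
          ihc, laverOp_succ h2 hb,
          ← ihi (laverOp N a b) (by omega) g4 _ (laverOp N a c) le_rfl g6 (a + 1)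
            (by omega) (by omega), laverOp_succ h2 hc]

/-- The underlying set `{1, …, 2 ^ n}` of the Laver table `A_n`. -/
abbrev LaverTable (n : ℕ) : Type := {a : ℕ // 1 ≤ a ∧ a ≤ 2 ^ n}

namespace LaverTable

theorem laverOp_mem {n : ℕ} (a b : LaverTable n) :
    1 ≤ laverOp (2 ^ n) a.1 b.1 ∧ laverOp (2 ^ n) a.1 b.1 ≤ 2 ^ n := by
  rcases lt_or_ge a.1 (2 ^ n) with h | h
  · exact ⟨(laverOp_gt h _).trans_le' (by omega), laverOp_le h _⟩
  · rw [laverOp_of_le h]; exact b.2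

/-- The Laver table `A_n` as a shelf. -/
instance (n : ℕ) : Shelf (LaverTable n) where
  act a b := ⟨laverOp (2 ^ n) a.1 b.1, laverOp_mem a b⟩
  self_distrib {a b c} := Subtype.ext <|
    laverOp_distrib (laverOp_top n) _ a.1 le_rfl a.2.2 _ b.1 le_rfl b.2.2 c.1 b.2.1 c.2.1

/-- The element `1` of `A_n`. -/
def one (n : ℕ) : LaverTable n := ⟨1, le_rfl, Nat.one_le_two_pow⟩

/-- The initialization relation `a ▹ 1 ≡ a + 1 mod 2 ^ n`. -/
theorem act_one {n : ℕ} (a : LaverTable n) :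
    (Shelf.act a (one n)).1 ≡ a.1 + 1 [MOD 2 ^ n] := by
  change laverOp (2 ^ n) a.1 1 ≡ _ [MOD _]
  rcases lt_or_ge a.1 (2 ^ n) with h | h
  · rw [laverOp_one h]
  · rw [laverOp_of_le h, le_antisymm a.2.2 h]
    simp [Nat.ModEq]

/-- `A_n` is the only self-distributive structure on `{1, …, 2 ^ n}` which satisfies the
initialization relation. -/
theorem act_unique {n : ℕ} (f : LaverTable n → LaverTable n → LaverTable n)
    (hf : ∀ a b c, f a (f b c) = f (f a b) (f a c))
    (h1 : ∀ a, (f a (one n)).1 ≡ a.1 + 1 [MOD 2 ^ n]) (a b : LaverTable n) :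
    f a b = Shelf.act a b := by
  have hlt : ∀ a : LaverTable n, a.1 < 2 ^ n → (f a (one n)).1 = a.1 + 1 := by
    intro a ha
    have h2 := (f a (one n)).2
    rcases (show a.1 + 1 ≤ 2 ^ n from ha).eq_or_lt with h | h
    · have h3 := (h1 a)
      rw [h] at h3 ⊢
      have h4 : 2 ^ n ∣ (f a (one n)).1 := (h3.dvd_iff dvd_rfl).2 dvd_rfl
      exact le_antisymm h2.2 (Nat.le_of_dvd (by omega) h4)
    · rcases h2.2.eq_or_lt with h4 | h4
      · have h3 := (h1 a)
        have h5 : 2 ^ n ∣ a.1 + 1 := (h3.dvd_iff dvd_rfl).1 (by rw [h4])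
        have := Nat.le_of_dvd (by omega) h5
        omega
      · exact Nat.ModEq.eq_of_lt_of_lt (h1 a) h4 h
  have hsucc : ∀ (b : LaverTable n) (hb : b.1 < 2 ^ n),
      (⟨b.1 + 1, by omega, hb⟩ : LaverTable n) = f b (one n) :=
    fun b hb => Subtype.ext (hlt b hb).symm
  have htop : ∀ a : LaverTable n, a.1 = 2 ^ n → f a (one n) = one n := by
    intro a ha
    have h3 := h1 a
    rw [ha] at h3
    have h5 := (f a (one n)).2
    have h4 : (f a (one n)).1 ≡ 1 [MOD 2 ^ n] := h3.trans (by simp [Nat.ModEq])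
    apply Subtype.ext
    change _ = 1
    rw [Nat.ModEq.comm, Nat.modEq_iff_dvd' h5.1] at h4
    by_contra hne
    have := Nat.le_of_dvd (by omega) h4
    omega
  have htop' : ∀ a : LaverTable n, a.1 = 2 ^ n → ∀ b, 1 ≤ b → ∀ hb : 1 ≤ b ∧ b ≤ 2 ^ n,
      f a ⟨b, hb⟩ = ⟨b, hb⟩ := by
    intro a ha b hb
    induction b, hb using Nat.le_induction with
    | base => intro _; exact htop a ha
    | succ b hb ih =>
      intro hb'
      have h2 := hsucc ⟨b, hb, by omega⟩ (by change b < _; omega)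
      change (⟨b + 1, hb'⟩ : LaverTable n) = _ at h2
      rw [h2, hf, htop a ha, ih]
  have main : ∀ i (a : LaverTable n), 2 ^ n - a.1 ≤ i → ∀ b, 1 ≤ b →
      ∀ hb : 1 ≤ b ∧ b ≤ 2 ^ n, f a ⟨b, hb⟩ = Shelf.act a ⟨b, hb⟩ := by
    intro i
    have hN : ∀ (a : LaverTable n), a.1 = 2 ^ n → ∀ b, 1 ≤ b →
      ∀ hb : 1 ≤ b ∧ b ≤ 2 ^ n, f a ⟨b, hb⟩ = Shelf.act a ⟨b, hb⟩ := by
      intro a ha b h1 hb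
      rw [htop' a ha b h1 hb]
      exact Subtype.ext (laverOp_of_le ha.ge b).symm
    induction i with
    | zero => intro a ha; exact hN a (le_antisymm a.2.2 (by omega))
    | succ i ih =>
      intro a ha
      rcases a.2.2.eq_or_lt with h | h
      · exact hN a h
      intro b hb
      induction b, hb using Nat.le_induction with
      | base => intro _; exact Subtype.ext ((hlt a h).trans (laverOp_one h).symm)
      | succ b hb ihb =>
        intro hb'
        have h2 := hsucc ⟨b, hb, by omega⟩ (by change b < _; omega)
        change (⟨b + 1, hb'⟩ : LaverTable n) = _ at h2
        rw [h2, hf, ihb, ← h2, ← hsucc a h]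
        have hg : a.1 < (Shelf.act a (⟨b, hb, by omega⟩ : LaverTable n)).1 := laverOp_gt h b
        rw [ih _ (by omega) _ (by omega)]
        exact Subtype.ext (laverOp_succ h hb).symm
  exact main _ a le_rfl b.1 b.2.1 b.2

/-- The element `2 ^ n - 1` of `A_n`. For `n = 0`, it is read modulo `2 ^ n`, hence it is
the only element `1` of `A_0`. -/
def pen (n : ℕ) : LaverTable n :=
  ⟨max 1 (2 ^ n - 1), le_max_left _ _, max_le Nat.one_le_two_pow (Nat.sub_le _ _)⟩

end LaverTable

/-! ### Cohomology of shelves -/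

namespace ShelfCohomology

/-- Cochains `C^k(S, A)`: maps from `S^k` to `A`. -/
abbrev Cochain (S A : Type*) (k : ℕ) : Type _ := (Fin k → S) → A

/-- `(a_1, …, a_{i-1}, a_i ▹ a_{i+1}, …, a_i ▹ a_{k+1})`. -/
def faceAct {S : Type*} [Shelf S] {k : ℕ} (i : Fin (k + 1)) (a : Fin (k + 1) → S) : Fin k → S :=
  fun j => if (j : ℕ) < i then a j.castSucc else Shelf.act (a i) (a j.succ)

/-- `(a_1, …, a_{i-1}, a_{i+1}, …, a_{k+1})`. -/
def faceDel {S : Type*} {k : ℕ} (i : Fin (k + 1)) (a : Fin (k + 1) → S) : Fin k → S :=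
  fun j => if (j : ℕ) < i then a j.castSucc else a j.succ

/-- The differential `d^k : C^k(S, A) → C^{k+1}(S, A)` of rack cohomology; the index `i` runs
through the first `k` of the `k + 1` positions, and `d^0 = 0`. -/
def d (S A : Type*) [Shelf S] [AddCommGroup A] (k : ℕ) :
    Cochain S A k →ₗ[ℤ] Cochain S A (k + 1) where
  toFun φ a := ∑ i : Fin k,
    (-1 : ℤ) ^ (i : ℕ) • (φ (faceAct i.castSucc a) - φ (faceDel i.castSucc a))
  map_add' φ ψ := by
    funext a
    simp only [Pi.add_apply, ← Finset.sum_add_distrib, ← smul_add]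
    exact Finset.sum_congr rfl fun i _ => by congr 1; abel
  map_smul' c φ := by
    funext a
    simp only [Pi.smul_apply, Finset.smul_sum, RingHom.id_apply]
    exact Finset.sum_congr rfl fun i _ => by rw [← smul_sub, smul_comm]

/-- Cocycles `Z^k(S, A)`. -/
def Z (S A : Type*) [Shelf S] [AddCommGroup A] (k : ℕ) : Submodule ℤ (Cochain S A k) :=
  LinearMap.ker (d S A k)

/-- Coboundaries `B^k(S, A)`; there are no non-zero ones in degree `0`. -/
def B (S A : Type*) [Shelf S] [AddCommGroup A] : (k : ℕ) → Submodule ℤ (Cochain S A k)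
  | 0 => ⊥
  | k + 1 => LinearMap.range (d S A k)

/-- Cohomology `H^k(S, A) = Z^k(S, A) / B^k(S, A)`. -/
abbrev H (S A : Type*) [Shelf S] [AddCommGroup A] (k : ℕ) : Type _ :=
  Z S A k ⧸ (B S A k).submoduleOf (Z S A k)

/-- The Kronecker delta function of a tuple. -/
def delta {S : Type*} [DecidableEq S] {k : ℕ} (a : Fin k → S) : Cochain S ℤ k :=
  fun b => if a = b then 1 else 0

/-- The constant map `1`. -/
def const (S : Type*) (k : ℕ) : Cochain S ℤ k := fun _ => 1

/-- The polynomial `P_k(x) = (x ^ k - x ^ (k mod 2)) / (x + 1)`, at a rational `x ≠ -1`. -/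
def P (k : ℕ) (x : ℚ) : ℚ := (x ^ k - x ^ (k % 2)) / (x + 1)

/-- The condition `a_1 = … = a_{2t} = 2^n - 1`, `a_{2t+1} ≠ 2^n - 1` for some `t ≥ 0` with
`2t + 1 ≤ m`, on an `m`-tuple. -/
def IsBasisTuple {n m : ℕ} (a : Fin m → LaverTable n) : Prop :=
  ∃ (t : ℕ) (ht : 2 * t < m), (∀ j : Fin m, (j : ℕ) < 2 * t → a j = LaverTable.pen n) ∧
    a ⟨2 * t, ht⟩ ≠ LaverTable.pen n

/-- The indices of the basis of `B^k(A_n, ℤ)`: the `(k - 1)`-tuples as above (none if `k = 0`). -/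
def BasisIndex (n : ℕ) : ℕ → Type
  | 0 => Empty
  | m + 1 => {a : Fin m → LaverTable n // IsBasisTuple a}

/-- The coboundary `d^{k-1} δ_a` for an index `a`. -/
def basisCoboundary (n : ℕ) : (k : ℕ) → BasisIndex n k → Cochain (LaverTable n) ℤ k
  | 0, a => Empty.elim a
  | m + 1, a => d (LaverTable n) ℤ m (delta a.1)

end ShelfCohomology

/-! Besides self-distributivity and the size of $A_n$, only two facts matter: $N$ acts by the
constant map to $2^n$ (`act_pen`), and $2^n$ acts as the identity (`act_top`). Write $c$ for the
substitution of $N$ as first argument and $e$ for $2^n$.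

In positive degree, `contract_d` reads $c\,d\varphi + d\,c\varphi = \varphi(e,\dots,e) - \varphi$.
Hence a cocycle that vanishes at $(e,\dots,e)$ is a coboundary. Conversely, coboundaries vanish
there, because $e$ acts trivially. So $Z^k = B^k \oplus \mathbb{Z}\phi^0$, which settles $H^k$ and
reduces $Z^k$ to $B^k$.

For the basis of $B^{m+1}$, the cochains supported on basis tuples form a complement of $Z^m$ in
$C^m$ (`IsReduced.eq_zero`, `exists_isReduced`), so $d$ maps them isomorphically onto $B^{m+1}$.
Both halves are inductions in steps of two degrees: $c^2$ commutes with $d$ up to a constant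
(`contract_contract_d`), and the support condition descends along $c^2$ (`isReduced_iff`). Ranks
then follow from rank-nullity. -/

namespace ShelfCohomology

/-! ### The differential, by splitting off the first argument -/

section Shelf

variable {S A : Type*} [Shelf S] [AddCommGroup A]

theorem faceAct_zero_cons {k : ℕ} (a : S) (b : Fin (k + 1) → S) :
    faceAct 0 (Fin.cons a b : Fin (k + 2) → S) = fun j => Shelf.act a (b j) := by
  funext j
  simp [faceAct]

omit [Shelf S] in
theorem faceDel_zero_cons {k : ℕ} (a : S) (b : Fin (k + 1) → S) :
    faceDel 0 (Fin.cons a b : Fin (k + 2) → S) = b := by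
  funext j
  simp [faceDel]

theorem faceAct_succ_cons {k : ℕ} (i : Fin (k + 1)) (a : S) (b : Fin (k + 1) → S) :
    faceAct i.succ (Fin.cons a b : Fin (k + 2) → S) = Fin.cons a (faceAct i b) := by
  funext j
  refine Fin.cases ?_ (fun j => ?_) j
  · simp [faceAct]
  · simp [faceAct]

omit [Shelf S] in
theorem faceDel_succ_cons {k : ℕ} (i : Fin (k + 1)) (a : S) (b : Fin (k + 1) → S) :
    faceDel i.succ (Fin.cons a b : Fin (k + 2) → S) = Fin.cons a (faceDel i b) := by
  funext j
  refine Fin.cases ?_ (fun j => ?_) j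
  · simp [faceDel]
  · simp [faceDel]

theorem d_apply {k : ℕ} (φ : Cochain S A k) (a : Fin (k + 1) → S) :
    d S A k φ a = ∑ i : Fin k,
      (-1 : ℤ) ^ (i : ℕ) • (φ (faceAct i.castSucc a) - φ (faceDel i.castSucc a)) := rfl

theorem d_zero_degree (φ : Cochain S A 0) : d S A 0 φ = 0 := by
  funext a
  simp [d_apply]

/-- The partial evaluation of a cochain at a first argument. -/
def contract (x : S) {k : ℕ} (φ : Cochain S A (k + 1)) : Cochain S A k :=
  fun b => φ (Fin.cons x b)

/-- The term $i = 1$ gives the first difference; the others keep $a$ in front, and the shift of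
index flips their sign. This recursion replaces face identities in all that follows. -/
theorem d_cons {k : ℕ} (φ : Cochain S A (k + 1)) (a : S) (b : Fin (k + 1) → S) :
    d S A (k + 1) φ (Fin.cons a b)
      = φ (fun j => Shelf.act a (b j)) - φ b - d S A k (contract a φ) b := by
  rw [d_apply, Fin.sum_univ_succ, d_apply, sub_eq_add_neg _ (∑ _, _), ← Finset.sum_neg_distrib]
  congr 1
  · simp [faceAct_zero_cons, faceDel_zero_cons]
  · refine Finset.sum_congr rfl fun i _ => ?_
    rw [← Fin.succ_castSucc, faceAct_succ_cons, faceDel_succ_cons, Fin.val_succ, pow_succ,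
      mul_neg_one, neg_smul]
    rfl

theorem d_comp {k : ℕ} (φ : Cochain S A k) (f : S → S)
    (hf : ∀ x y, f (Shelf.act x y) = Shelf.act (f x) (f y)) :
    d S A k (fun b => φ (fun j => f (b j))) = fun b => d S A k φ (fun j => f (b j)) := by
  funext b
  simp only [d_apply]
  refine Finset.sum_congr rfl fun i _ => ?_
  congr 3 <;>
  · funext j
    simp only [faceAct, faceDel]
    split_ifs <;> simp [hf]

/-- Induction on the degree through `d_cons`. Self-distributivity makes $a \rhd {-}$ an
endomorphism, so pulling back along it commutes with $d$ (`d_comp`) and all terms cancel. -/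
theorem d_d : ∀ {k : ℕ} (φ : Cochain S A k), d S A (k + 1) (d S A k φ) = 0
  | 0, φ => by rw [d_zero_degree, map_zero]
  | k + 1, φ => by
    funext a
    obtain ⟨a, b, rfl⟩ : ∃ x b, a = Fin.cons x b := ⟨a 0, Fin.tail a, (Fin.cons_self_tail a).symm⟩
    have h : contract a (d S A (k + 1) φ)
        = (fun b => φ (fun j => Shelf.act a (b j))) - φ - d S A k (contract a φ) := by
      funext b
      exact d_cons φ a b
    rw [d_cons, h, map_sub, map_sub, d_d, d_comp φ _ fun x y => Shelf.self_distrib]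
    simp

theorem d_const (k : ℕ) (c : A) : d S A k (fun _ => c) = 0 := by
  funext a
  simp [d_apply]

theorem B_le_Z : ∀ k, B S A k ≤ Z S A k
  | 0 => bot_le
  | k + 1 => by
    rintro _ ⟨φ, rfl⟩
    exact d_d φ

theorem d_apply_of_act_eq {e : S} (he : ∀ b, Shelf.act e b = b) {k : ℕ} (φ : Cochain S A k) :
    d S A k φ (fun _ => e) = 0 := by
  rw [d_apply]
  refine Finset.sum_eq_zero fun i _ => ?_
  have : faceAct i.castSucc (fun _ : Fin (k + 1) => e) = faceDel i.castSucc fun _ => e := by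
    funext j
    simp [faceAct, faceDel, he]
  rw [this, sub_self, smul_zero]

theorem apply_of_mem_B {e : S} (he : ∀ b, Shelf.act e b = b) :
    ∀ {k : ℕ} {φ : Cochain S A k}, φ ∈ B S A k → φ (fun _ => e) = 0
  | 0, φ, h => by
    rw [(Submodule.mem_bot ℤ).1 h]
    rfl
  | k + 1, _, ⟨φ, h⟩ => by
    rw [← h]
    exact d_apply_of_act_eq he φ

/-! ### The homotopy given by an element acting as a constant -/

section Homotopy

variable {x e : S} (hx : ∀ b, Shelf.act x b = e)
include hx

/-- Contraction with an element which acts by a constant is a homotopy from the identity to an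
evaluation. -/
theorem contract_d {k : ℕ} (φ : Cochain S A (k + 1)) :
    contract x (d S A (k + 1) φ)
      = (fun _ => φ fun _ => e) - φ - d S A k (contract x φ) := by
  funext b
  simp only [contract, d_cons, hx, Pi.sub_apply]

/-- Two uses of `contract_d`: the two signs in front of $d$ cancel, as do the two copies of
`contract x φ`, and only a constant is left. -/
theorem contract_contract_d {k : ℕ} (φ : Cochain S A (k + 2)) :
    contract x (contract x (d S A (k + 2) φ))
      = d S A k (contract x (contract x φ))
        + fun _ => φ (fun _ => e) - φ (Fin.cons x fun _ => e) := by
  have h1 := contract_d hx φ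
  have h2 := contract_d hx (contract x φ)
  rw [h1]
  funext b
  have h3 := congrFun h2 b
  simp only [contract, Pi.sub_apply, Pi.add_apply] at h3 ⊢
  rw [h3]
  abel

theorem mem_B_of_mem_Z {k : ℕ} {φ : Cochain S A k} (h : φ ∈ Z S A k)
    (he : φ (fun _ => e) = 0) : φ ∈ B S A k := by
  cases k with
  | zero =>
    refine (Submodule.mem_bot ℤ).2 (funext fun b => ?_)
    rw [Subsingleton.elim b fun _ => e, he]
    rfl
  | succ k =>
    -- With $d\varphi = 0$ and $\varphi(e,\dots,e) = 0$, the homotopy formula becomes $0 = -\varphi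
    -- - d(c\varphi)$.
    refine ⟨-contract x φ, ?_⟩
    have h1 := contract_d hx φ
    rw [LinearMap.mem_ker.1 h, he] at h1
    rw [map_neg]
    funext b
    have h2 := congrFun h1 b
    simp only [contract, Pi.sub_apply, Pi.neg_apply, Pi.zero_apply] at h2 ⊢
    rw [zero_sub] at h2
    exact neg_eq_iff_eq_neg.2 (sub_eq_zero.1 h2.symm).symm

end Homotopy

end Shelf

/-! ### Basis tuples and reduced cochains -/

section LaverTable

variable {n : ℕ}

theorem not_isBasisTuple_zero (a : Fin 0 → LaverTable n) : ¬ IsBasisTuple a := by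
  rintro ⟨t, ht, -⟩
  omega

theorem not_isBasisTuple_const {m : ℕ} : ¬ IsBasisTuple fun _ : Fin m => LaverTable.pen n := by
  rintro ⟨t, ht, -, h⟩
  exact h rfl

theorem isBasisTuple_cons_of_ne {m : ℕ} {x : LaverTable n} (hx : x ≠ LaverTable.pen n)
    (b : Fin m → LaverTable n) : IsBasisTuple (Fin.cons x b : Fin (m + 1) → LaverTable n) :=
  ⟨0, Nat.succ_pos m, fun _ hj => absurd hj (Nat.not_lt_zero _), hx⟩

theorem not_isBasisTuple_cons_cons {m : ℕ} {y : LaverTable n} (hy : y ≠ LaverTable.pen n)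
    (b : Fin m → LaverTable n) :
    ¬ IsBasisTuple (Fin.cons (LaverTable.pen n) (Fin.cons y b : Fin (m + 1) → LaverTable n) :
      Fin (m + 2) → LaverTable n) := by
  rintro ⟨_ | t, ht, h1, h2⟩
  · exact h2 rfl
  · exact hy (h1 1 (by rw [Fin.val_one]; omega))

theorem isBasisTuple_cons_cons_pen {m : ℕ} (b : Fin m → LaverTable n) :
    IsBasisTuple (Fin.cons (LaverTable.pen n)
      (Fin.cons (LaverTable.pen n) b : Fin (m + 1) → LaverTable n) :
      Fin (m + 2) → LaverTable n) ↔ IsBasisTuple b := by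
  constructor
  · rintro ⟨_ | t, ht, h1, h2⟩
    · exact absurd rfl h2
    · exact ⟨t, by omega, fun j hj => h1 j.succ.succ (by simp; omega), h2⟩
  · rintro ⟨t, ht, h1, h2⟩
    refine ⟨t + 1, by omega, fun j => ?_, h2⟩
    refine Fin.cases (fun _ => rfl) (fun j => Fin.cases (fun _ => rfl) (fun j hj => ?_) j) j
    exact h1 j (by simp at hj; omega)

/-- The cochains which are supported on the tuples of `IsBasisTuple`. -/
def IsReduced {A : Type*} [AddCommGroup A] {m : ℕ} (φ : Cochain (LaverTable n) A m) : Prop :=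
  ∀ a, ¬ IsBasisTuple a → φ a = 0

variable {A : Type*} [AddCommGroup A]

/-- A tuple not starting with $N$ is a basis tuple, one starting with $N, y$ for $y \ne N$ is not,
and a prefix $N, N$ can be dropped. This is the inductive step by two degrees. -/
theorem isReduced_iff {m : ℕ} (φ : Cochain (LaverTable n) A (m + 2)) :
    IsReduced φ ↔
      (∀ y, y ≠ LaverTable.pen n → ∀ b : Fin m → LaverTable n,
        φ (Fin.cons (LaverTable.pen n) (Fin.cons y b : Fin (m + 1) → LaverTable n)) = 0) ∧
      IsReduced (contract (LaverTable.pen n) (contract (LaverTable.pen n) φ)) := by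
  constructor
  · exact fun h => ⟨fun y hy b => h _ (not_isBasisTuple_cons_cons hy b),
      fun b hb => h _ (mt (isBasisTuple_cons_cons_pen b).1 hb)⟩
  · rintro ⟨h1, h2⟩ a ha
    obtain ⟨x, b, rfl⟩ : ∃ x b, a = Fin.cons x b := ⟨a 0, Fin.tail a, (Fin.cons_self_tail a).symm⟩
    obtain ⟨y, b, rfl⟩ : ∃ y c, b = Fin.cons y c := ⟨b 0, Fin.tail b, (Fin.cons_self_tail b).symm⟩
    by_cases hx : x = LaverTable.pen n
    · subst hx
      by_cases hy : y = LaverTable.pen n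
      · subst hy
        exact h2 b (mt (isBasisTuple_cons_cons_pen b).2 ha)
      · exact h1 y hy b
    · exact absurd (isBasisTuple_cons_of_ne hx _) ha

/-- The element `2 ^ n` of `A_n`. -/
def top (n : ℕ) : LaverTable n := ⟨2 ^ n, Nat.one_le_two_pow, le_rfl⟩

theorem act_top (b : LaverTable n) : Shelf.act (top n) b = b :=
  Subtype.ext (laverOp_of_le le_rfl _)

theorem act_pen (b : LaverTable n) : Shelf.act (LaverTable.pen n) b = top n := by
  refine Subtype.ext ?_
  change laverOp (2 ^ n) (max 1 (2 ^ n - 1)) b.1 = 2 ^ n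
  have hb := b.2
  have hn : 1 ≤ 2 ^ n := Nat.one_le_two_pow
  rcases hn.eq_or_lt with h | h
  -- In $A_0$ the elements $N$ and $2^n$ coincide, and the claim still holds.
  · rw [laverOp_of_le (by omega)]
    omega
  · rw [max_eq_right (by omega)]
    have h1 := laverOp_gt (show 2 ^ n - 1 < 2 ^ n by omega) b.1
    have h2 := laverOp_le (show 2 ^ n - 1 < 2 ^ n by omega) b.1
    omega

/-! ### Reduced cochains as a complement of the cocycles -/

theorem IsReduced.eq_zero_of_const {m : ℕ} {φ : Cochain (LaverTable n) A m} (h : IsReduced φ)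
    {c : A} (hc : φ = fun _ => c) : φ = 0 := by
  have h1 := h _ not_isBasisTuple_const
  rw [hc] at h1 ⊢
  rw [show c = 0 from h1]
  rfl

theorem IsReduced.eq_zero : ∀ {m : ℕ} {φ : Cochain (LaverTable n) A m}, IsReduced φ →
    d (LaverTable n) A m φ = 0 → φ = 0
  | 0, φ, h, _ => funext fun a => h a (not_isBasisTuple_zero a)
  | 1, φ, h, hd => by
    have h1 := contract_d act_pen φ
    rw [hd, d_zero_degree, sub_zero] at h1
    exact h.eq_zero_of_const (sub_eq_zero.1 h1.symm).symm
  | m + 2, φ, h, hd => by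
    have h1 := contract_d act_pen φ
    have h2 := contract_contract_d act_pen φ
    obtain ⟨h3, h4⟩ := (isReduced_iff φ).1 h
    rw [hd] at h1 h2
    -- The constant error term vanishes, since a coboundary is zero at $(2^n,\dots,2^n)$. So
    -- $c^2\varphi$ is a reduced cocycle and the induction applies.
    have h5 : φ (fun _ => top n) - φ (Fin.cons (LaverTable.pen n) fun _ => top n) = 0 := by
      have := congrFun h2 fun _ => top n
      rw [Pi.add_apply, d_apply_of_act_eq act_top, zero_add] at this
      exact this.symm
    rw [h5] at h2
    replace h2 := h2.trans (add_zero _)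
    have h6 := h4.eq_zero (h2.symm.trans rfl)
    have h7 : contract (LaverTable.pen n) φ = 0 := by
      funext b
      obtain ⟨y, b, rfl⟩ : ∃ y c, b = Fin.cons y c :=
        ⟨b 0, Fin.tail b, (Fin.cons_self_tail b).symm⟩
      by_cases hy : y = LaverTable.pen n
      · subst hy
        exact congrFun h6 b
      · exact h3 y hy b
    -- Once $c\varphi = 0$, the homotopy formula says that $\varphi$ is constant.
    rw [h7, map_zero, sub_zero] at h1
    exact h.eq_zero_of_const (sub_eq_zero.1 h1.symm).symm

theorem const_mem_Z (S : Type*) [Shelf S] (m : ℕ) (c : A) : (fun _ => c) ∈ Z S A m :=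
  d_const m c

theorem d_mem_Z {S : Type*} [Shelf S] {m : ℕ} (φ : Cochain S A m) :
    d S A m φ ∈ Z S A (m + 1) :=
  d_d φ

theorem exists_mem_Z_contract_contract {m : ℕ} {w : Cochain (LaverTable n) A m}
    (hw : w ∈ Z (LaverTable n) A m) : ∃ z ∈ Z (LaverTable n) A (m + 2),
      contract (LaverTable.pen n) (contract (LaverTable.pen n) z) = w := by
  classical
  -- Any `χ` with $c\chi = -w$ would do: as $dw = 0$, the corrected coboundary $z$ below satisfies
  -- $cz = -\chi$, hence $c^2z = w$.
  let χ : Cochain (LaverTable n) A (m + 1) :=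
    fun b => if b 0 = LaverTable.pen n then - w (Fin.tail b) else 0
  have hχ : contract (LaverTable.pen n) χ = -w := by
    funext b
    simp [contract, χ]
  refine ⟨d _ A (m + 1) χ - fun _ => χ fun _ => top n,
    sub_mem (d_mem_Z χ) (const_mem_Z _ _ _), ?_⟩
  have h1 := contract_d act_pen χ
  rw [hχ, map_neg, LinearMap.mem_ker.1 hw, neg_zero, sub_zero] at h1
  funext b
  have h2 := congrFun h1 (Fin.cons (LaverTable.pen n) b)
  have h3 := congrFun hχ b
  simp only [contract, Pi.sub_apply, Pi.neg_apply] at h2 h3 ⊢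
  rw [h2, h3]
  abel

theorem exists_isReduced : ∀ {m : ℕ} (ψ : Cochain (LaverTable n) A m),
    ∃ φ : Cochain (LaverTable n) A m, IsReduced φ ∧ ψ - φ ∈ Z (LaverTable n) A m
  | 0, ψ => ⟨0, fun _ _ => rfl, d_zero_degree _⟩
  | 1, ψ => by
    refine ⟨ψ - fun _ => ψ fun _ => LaverTable.pen n, fun a ha => ?_, ?_⟩
    · have : a = fun _ => LaverTable.pen n := by
        by_contra h
        refine ha ⟨0, by omega, fun j hj => by omega, fun h1 => h (funext fun j => ?_)⟩
        rw [Subsingleton.elim j 0]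
        exact h1
      rw [this]
      exact sub_self _
    · rw [sub_sub_cancel]
      exact const_mem_Z _ _ _
  | m + 2, ψ => by
    classical
    obtain ⟨u, hu, hw⟩ :=
      exists_isReduced (contract (LaverTable.pen n) (contract (LaverTable.pen n) ψ))
    obtain ⟨z, hz, hzw⟩ := exists_mem_Z_contract_contract hw
    -- Subtracting $z$ has already made $c^2$ equal to the reduced $u$. As $c\chi = 0$, adding
    -- $d\chi$ minus its constant changes $c(\psi - z)$ by $-\chi$: this kills the values at $(N, y,
    -- \dots)$ with $y \ne N$ and leaves $c^2$ alone.
    let χ : Cochain (LaverTable n) A (m + 1) := fun b =>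
      if b 0 = LaverTable.pen n then 0 else (ψ - z) (Fin.cons (LaverTable.pen n) b)
    have hχ : contract (LaverTable.pen n) χ = 0 := by
      funext b
      simp [contract, χ]
    have h1 := contract_d act_pen χ
    rw [hχ, map_zero, sub_zero] at h1
    have h2 : ∀ b, (d _ A (m + 1) χ - fun _ => χ fun _ => top n : Cochain (LaverTable n) A (m + 2))
        (Fin.cons (LaverTable.pen n) b)
        = - χ b := by
      intro b
      have := congrFun h1 b
      simp only [contract, Pi.sub_apply] at this ⊢
      rw [this]
      abel
    refine ⟨ψ - z + (d _ A (m + 1) χ - fun _ => χ fun _ => top n),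
      (isReduced_iff _).2 ⟨fun y hy b => ?_, ?_⟩, ?_⟩
    · rw [Pi.add_apply, h2]
      simp [χ, hy]
    · convert hu using 1
      funext b
      have h3 := congrFun hzw b
      simp only [contract] at h3 ⊢
      rw [Pi.add_apply, h2]
      simp [χ, h3, contract]
    · rw [sub_add_eq_sub_sub, sub_sub_cancel]
      exact sub_mem hz (sub_mem (d_mem_Z χ) (const_mem_Z _ _ _))

/-! ### The basis of the coboundaries -/

/-- The extension by zero of functions on basis tuples, followed by the differential. -/
noncomputable def coboundaryMap (n m : ℕ) :
    ({a : Fin m → LaverTable n // IsBasisTuple a} → ℤ) →ₗ[ℤ] B (LaverTable n) ℤ (m + 1) :=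
  (d (LaverTable n) ℤ m).rangeRestrict ∘ₗ
    Function.ExtendByZero.linearMap ℤ (Subtype.val : {a : Fin m → LaverTable n // IsBasisTuple a} → _)

theorem isReduced_extend {m : ℕ} (f : {a : Fin m → LaverTable n // IsBasisTuple a} → ℤ) :
    IsReduced (Function.extend (Subtype.val : {a : Fin m → LaverTable n // IsBasisTuple a} → _) f 0) := fun _ ha =>
  Function.extend_apply' _ _ _ fun ⟨b, hb⟩ => ha (hb ▸ b.2)

theorem coboundaryMap_bijective (n m : ℕ) : Function.Bijective (coboundaryMap n m) := by
  constructor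
  · refine (injective_iff_map_eq_zero _).2 fun f hf => ?_
    have h1 := (isReduced_extend f).eq_zero (congrArg Subtype.val hf)
    funext a
    rw [← Subtype.val_injective.extend_apply f 0 a, h1]
    rfl
  · rintro ⟨_, ψ, rfl⟩
    obtain ⟨φ, h1, h2⟩ := exists_isReduced ψ
    refine ⟨fun a => φ a.1, Subtype.ext ?_⟩
    have h3 : Function.extend (Subtype.val : {a : Fin m → LaverTable n // IsBasisTuple a} → _) (fun a => φ a.1) 0 = φ := by
      funext a
      by_cases ha : IsBasisTuple a
      · exact Subtype.val_injective.extend_apply (fun a : Subtype _ => φ a.1) 0 ⟨a, ha⟩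
      · rw [h1 a ha]
        exact isReduced_extend _ a ha
    have h4 := LinearMap.mem_ker.1 h2
    rw [map_sub, sub_eq_zero] at h4
    refine Eq.trans ?_ h4.symm
    exact congrArg (d (LaverTable n) ℤ m) h3

instance (n : ℕ) : ∀ k, Finite (BasisIndex n k)
  | 0 => inferInstanceAs (Finite Empty)
  | m + 1 => by
    have : Finite (LaverTable n) := Set.finite_coe_iff.2 (Set.finite_Icc 1 (2 ^ n))
    exact inferInstanceAs (Finite {a : Fin m → LaverTable n // IsBasisTuple a})

theorem exists_basis_range_d (n m : ℕ) :
    ∃ b : Module.Basis {a : Fin m → LaverTable n // IsBasisTuple a} ℤ (B (LaverTable n) ℤ (m + 1)),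
      ∀ a, (b a : Cochain (LaverTable n) ℤ (m + 1)) = d (LaverTable n) ℤ m (delta a.1) := by
  have : Finite (LaverTable n) := Set.finite_coe_iff.2 (Set.finite_Icc 1 (2 ^ n))
  classical
  refine ⟨(Pi.basisFun ℤ _).map
    (LinearEquiv.ofBijective (coboundaryMap n m) (coboundaryMap_bijective n m)), fun a => ?_⟩
  rw [Module.Basis.map_apply, Pi.basisFun_apply]
  refine congrArg (d (LaverTable n) ℤ m) (funext fun b => ?_)
  rw [Function.ExtendByZero.linearMap_apply]
  by_cases hb : IsBasisTuple b
  · rw [Subtype.val_injective.extend_apply (Pi.single a (1 : ℤ)) 0 ⟨b, hb⟩, Pi.single_apply, delta]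
    exact if_congr ⟨fun h => by rw [← h], fun h => Subtype.ext h.symm⟩ rfl rfl
  · refine (isReduced_extend _ b hb).trans (if_neg fun h => hb ?_).symm
    exact h ▸ a.2

theorem exists_basis_B (n : ℕ) : ∀ k, ∃ b : Module.Basis (BasisIndex n k) ℤ (B (LaverTable n) ℤ k),
    ∀ a, (b a : Cochain (LaverTable n) ℤ k) = basisCoboundary n k a
  | 0 => by
    have : IsEmpty (BasisIndex n 0) := inferInstanceAs (IsEmpty Empty)
    have : Subsingleton (B (LaverTable n) ℤ 0) :=
      inferInstanceAs (Subsingleton (⊥ : Submodule ℤ (Cochain (LaverTable n) ℤ 0)))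
    exact ⟨Module.Basis.empty _, fun a => isEmptyElim a⟩
  | m + 1 => exists_basis_range_d n m

/-! ### Cohomology and the basis of the cocycles -/

/-- The evaluation of cocycles at `(2 ^ n, …, 2 ^ n)`. -/
def evalTop (n k : ℕ) : Z (LaverTable n) ℤ k →ₗ[ℤ] ℤ :=
  LinearMap.proj (fun _ => top n) ∘ₗ (Z (LaverTable n) ℤ k).subtype

theorem ker_evalTop (n k : ℕ) :
    LinearMap.ker (evalTop n k) = (B (LaverTable n) ℤ k).submoduleOf (Z (LaverTable n) ℤ k) :=
  Submodule.ext fun φ => ⟨fun h => mem_B_of_mem_Z act_pen φ.2 h, fun h => apply_of_mem_B act_top h⟩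

theorem evalTop_smul_const {n k : ℕ} (c : ℤ) :
    evalTop n k (c • ⟨const (LaverTable n) k, const_mem_Z _ _ _⟩) = c := by
  rw [map_smul]
  exact mul_one c

theorem exists_basis_H (n k : ℕ) : ∃ b : Module.Basis Unit ℤ (H (LaverTable n) ℤ k),
    b () = Submodule.Quotient.mk ⟨const (LaverTable n) k, const_mem_Z _ _ _⟩ := by
  refine ⟨(Module.Basis.singleton Unit ℤ).map
    ((Submodule.quotEquivOfEq _ _ (ker_evalTop n k).symm).trans
      ((evalTop n k).quotKerEquivOfSurjective fun c => ⟨_, evalTop_smul_const c⟩)).symm, ?_⟩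
  rw [Module.Basis.map_apply, LinearEquiv.symm_apply_eq, Module.Basis.singleton_apply]
  rfl

/-- The sum of a coboundary and of a constant map. -/
def cocycleMap (n k : ℕ) : B (LaverTable n) ℤ k × ℤ →ₗ[ℤ] Z (LaverTable n) ℤ k :=
  (Submodule.inclusion (B_le_Z k)).coprod
    (LinearMap.toSpanSingleton ℤ _ ⟨const (LaverTable n) k, const_mem_Z _ _ _⟩)

theorem evalTop_cocycleMap {n k : ℕ} (p : B (LaverTable n) ℤ k × ℤ) :
    evalTop n k (cocycleMap n k p) = p.2 := by
  rw [cocycleMap, LinearMap.coprod_apply, map_add, LinearMap.toSpanSingleton_apply,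
    evalTop_smul_const]
  exact add_eq_right.2 (apply_of_mem_B act_top p.1.2)

theorem cocycleMap_bijective (n k : ℕ) : Function.Bijective (cocycleMap n k) := by
  constructor
  · refine (injective_iff_map_eq_zero _).2 fun ⟨β, c⟩ h => ?_
    have h1 := evalTop_cocycleMap (β, c)
    rw [h, map_zero] at h1
    obtain rfl : 0 = c := h1
    rw [cocycleMap, LinearMap.coprod_apply, map_zero, add_zero] at h
    exact Prod.ext (Subtype.ext ((congrArg Subtype.val h :))) rfl
  · intro φ
    have h1 : φ - evalTop n k φ • ⟨const (LaverTable n) k, const_mem_Z _ _ _⟩ ∈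
        LinearMap.ker (evalTop n k) := by
      rw [LinearMap.mem_ker, map_sub, evalTop_smul_const, sub_self]
    rw [ker_evalTop] at h1
    exact ⟨(⟨_, h1⟩, evalTop n k φ), Subtype.ext (sub_add_cancel _ _)⟩

theorem exists_basis_Z (n k : ℕ) :
    ∃ b : Module.Basis (Option (BasisIndex n k)) ℤ (Z (LaverTable n) ℤ k),
      (b none : Cochain (LaverTable n) ℤ k) = const (LaverTable n) k ∧
      ∀ a, (b (some a) : Cochain (LaverTable n) ℤ k) = basisCoboundary n k a := by
  obtain ⟨b, hb⟩ := exists_basis_B n k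
  refine ⟨((b.prod (Module.Basis.singleton Unit ℤ)).map
    (LinearEquiv.ofBijective (cocycleMap n k) (cocycleMap_bijective n k))).reindex
      (Equiv.optionEquivSumPUnit _).symm, ?_, fun a => ?_⟩
  · simp [cocycleMap]
  · simp [cocycleMap, hb]

/-- Rank-nullity for $d^k$ and $\operatorname{rk} Z^k = \operatorname{rk} B^k + 1$ give
$\operatorname{rk} B^{k+1} = x^k - 1 - \operatorname{rk} B^k$ with $x = 2^n$. -/
theorem finrank_B (n : ℕ) : ∀ k,
    (Module.finrank ℤ (B (LaverTable n) ℤ k) : ℚ) = P k (2 ^ n)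
  | 0 => by
    have : Module.finrank ℤ (B (LaverTable n) ℤ 0) = 0 := finrank_bot ℤ _
    simp [this, P]
  | k + 1 => by
    have hf : Finite (LaverTable n) := Set.finite_coe_iff.2 (Set.finite_Icc 1 (2 ^ n))
    have := Fintype.ofFinite (LaverTable n)
    have hc : Fintype.card (LaverTable n) = 2 ^ n := by
      rw [← Nat.card_eq_fintype_card]
      exact (Nat.card_coe_set_eq (Set.Icc 1 (2 ^ n))).trans (by simp)
    have h1 := (LinearMap.ker (d (LaverTable n) ℤ k)).finrank_quotient_add_finrank
    rw [(d (LaverTable n) ℤ k).quotKerEquivRange.finrank_eq, Module.finrank_pi, Fintype.card_fun, Fintype.card_fin, hc] at h1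
    obtain ⟨b, -⟩ := exists_basis_B n k
    obtain ⟨z, -⟩ := exists_basis_Z n k
    have h2 : Module.finrank ℤ (Z (LaverTable n) ℤ k)
        = Module.finrank ℤ (B (LaverTable n) ℤ k) + 1 := by
      rw [Module.finrank_eq_nat_card_basis b, Module.finrank_eq_nat_card_basis z,
        Finite.card_option]
    change Module.finrank ℤ (B (LaverTable n) ℤ (k + 1))
      + Module.finrank ℤ (Z (LaverTable n) ℤ k) = _ at h1
    rw [h2] at h1
    have h3 := congrArg (Nat.cast : ℕ → ℚ) h1
    push_cast at h3
    rw [finrank_B n k] at h3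
    have hx : (2 ^ n + 1 : ℚ) ≠ 0 := by positivity
    rw [eq_sub_of_add_eq h3, P, P]
    field_simp
    -- The exponents $k \bmod 2$ and $(k+1) \bmod 2$ are $0$ and $1$ in some order, so $P_{k+1} +
    -- P_k = (x^{k+1} + x^k - x - 1)/(x+1) = x^k - 1$.
    rcases Nat.mod_two_eq_zero_or_one k with h | h
    · rw [h, show (k + 1) % 2 = 1 by omega]
      ring
    · rw [h, show (k + 1) % 2 = 0 by omega]
      ring

end LaverTable

end ShelfCohomology

open ShelfCohomology in
theorem theoremT (n k : ℕ) :
    -- the coboundaries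
    (Module.Free ℤ (B (LaverTable n) ℤ k) ∧ Module.Finite ℤ (B (LaverTable n) ℤ k) ∧
      (Module.finrank ℤ (B (LaverTable n) ℤ k) : ℚ) = P k (2 ^ n) ∧
      ∃ b : Module.Basis (BasisIndex n k) ℤ (B (LaverTable n) ℤ k),
        ∀ a, (b a : Cochain (LaverTable n) ℤ k) = basisCoboundary n k a) ∧
    -- the cohomology
    (∃ h : const (LaverTable n) k ∈ Z (LaverTable n) ℤ k,
      ∃ b : Module.Basis Unit ℤ (H (LaverTable n) ℤ k),
        b () = Submodule.Quotient.mk ⟨const (LaverTable n) k, h⟩) ∧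
    -- the cocycles
    (Module.Free ℤ (Z (LaverTable n) ℤ k) ∧ Module.Finite ℤ (Z (LaverTable n) ℤ k) ∧
      (Module.finrank ℤ (Z (LaverTable n) ℤ k) : ℚ) = P k (2 ^ n) + 1 ∧
      ∃ b : Module.Basis (Option (BasisIndex n k)) ℤ (Z (LaverTable n) ℤ k),
        (b none : Cochain (LaverTable n) ℤ k) = const (LaverTable n) k ∧
        ∀ a, (b (some a) : Cochain (LaverTable n) ℤ k) = basisCoboundary n k a) := by
  obtain ⟨b, hb⟩ := exists_basis_B n k
  obtain ⟨z, hz⟩ := exists_basis_Z n k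
  refine ⟨⟨.of_basis b, .of_basis b, finrank_B n k, b, hb⟩,
    ⟨const_mem_Z _ _ _, exists_basis_H n k⟩, ⟨.of_basis z, .of_basis z, ?_, z, hz⟩⟩
  rw [← finrank_B n k, Module.finrank_eq_nat_card_basis b, Module.finrank_eq_nat_card_basis z,
    Finite.card_option]
  push_cast
  rfl
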